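/- **Conventions.** All vector spaces are real; algebras need not be unital. A cone $C$ in a vector space satisfies $0\in C$, $C+C\subseteq C$ and $tC\subseteq C$ for $t\ge 0$ (it need not be proper). A pre-ordered Banach space is a Banach space $X$ with a cone $X_+$; a bounded operator $T:X\to Y$ is positive if $TX_+\subseteq Y_+$. A pre-ordered Banach algebra is a Banach algebra with a cone $A_+$ such that $A_+A_+\subseteq A_+$. An injective linear map $T$ is bipositive if, for all $x$, $x$ is positive if and only if $Tx$ is positive. For a Banach algebra $B$, $\mathcal M_l(B)$ is the algebra of bounded operators $L$ on $B$ with $L(bc)=(Lb)c$, with the operator norm and, if $B$ is pre-ordered, with the cone $\mathcal M_l(B)_+$ of positive operators; $\lambda:B\to\mathcal M_l(B)$, $\lambda(b)c=bc$, is the left regular representation. An approximate left identity is positive if it consists of positive elements. A representation $\pi$ of an algebra on $X$ is an algebra homomorphism into $B(X)$; it is non-degenerate if $\operatorname{span}\{\pi(a)x\}$ is dense in $X$. Let $A$ be a pre-ordered Banach algebra with a closed cone and a positive bounded approximate left identity, $G$ a locally compact Hausdorff group with a fixed left Haar measure, and $\alpha$ a strongly continuous action of $G$ on $A$ by bounded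 algebra automorphisms such that all $\alpha_s$ are positive. A continuous covariant representation $(\pi,U)$ of $(A,G,\alpha)$ on a Banach space $X$ is a pair of a bounded representation $\pi:A\to B(X)$ and a strongly continuous homomorphism $U$ of $G$ into the invertible elements of $B(X)$ with $\pi(\alpha_s(a))=U_s\pi(a)U_s^{-1}$; it is positive (for pre-ordered $X$) if $\pi(a)$ is positive for $a\in A_+$ and all $U_s$ are positive, and non-degenerate if $\pi$ is. For $f\in C_c(G,A)$ put $(\pi\rtimes U)(f)x=\int_G\pi(f(r))U_rx\,dr$. A class $\mathcal R$ of such representations is uniformly bounded if there are $C\ge 0$ and $\nu:G\to[0,\infty)$, bounded on compact sets, with $\|\pi\|\le C$ and $\|U_r\|\le\nu(r)$ for all $(\pi,U)\in\mathcal R$, $r\in G$. Let $\mathcal R$ be a non-empty uniformly bounded class of positive non-degenerate continuous covariant representations of $(A,G,\alpha)$ on pre-ordered Banach spaces with closed cones, and put $\sigma^{\mathcal R}(f)=\sup_{(\pi,U)\in\mathcal R}\|(\pi\rtimes U)(f)\|$. The crossed product $(A\rtimes_\alpha G)^{\mathcal R}$ is the completion of $C_c(G,A)/\ker\sigma^{\mathcal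 R}$ in the norm induced by $\sigma^{\mathcal R}$, with the product induced by twisted convolution $(f*g)(s)=\int_Gf(r)\alpha_r(g(r^{-1}s))\,dr$; its cone is the closure of the image of $C_c(G,A_+)$. The maps $i_A^{\mathcal R}:A\to\mathcal M_l((A\rtimes_\alpha G)^{\mathcal R})$ and $i_G^{\mathcal R}:G\to\mathcal M_l((A\rtimes_\alpha G)^{\mathcal R})$ are induced by $(i_A(a)f)(s)=af(s)$ and $(i_G(r)f)(s)=\alpha_r(f(r^{-1}s))$. A continuous covariant representation $(\pi,U)$ on a Banach space is $\mathcal R$-continuous if $\|(\pi\rtimes U)(f)\|\le M\sigma^{\mathcal R}(f)$ for some $M$ and all $f\in C_c(G,A)$. **Theorem 4.7.** Let $E$ be a pre-ordered Banach algebra with a closed cone and a positive bounded approximate left identity, such that $\lambda:E\to\mathcal M_l(E)$ is a bipositive topological embedding. Let $(k_A,k_G)$ be a positive non-degenerate $\mathcal R$-continuous covariant representation of $(A,G,\alpha)$ on the pre-ordered Banach space $E$ such that 1. $k_A(A),k_G(G)\subseteq\mathcal M_l(E)$, 2. $(k_A\rtimes k_G)(C_c(G,A))\subseteq\lambda(E)$,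 3. $(k_A\rtimes k_G)(C_c(G,A))$ is dense in $\lambda(E)$, 4. $(k_A\rtimes k_G)(C_c(G,A_+))$ is dense in $\lambda(E)\cap\mathcal M_l(E)_+$. Suppose that for every positive non-degenerate $\mathcal R$-continuous covariant representation $(\pi,U)$ of $(A,G,\alpha)$ on a pre-ordered Banach space $X$ with a closed cone there is a positive non-degenerate bounded representation $T:E\to B(X)$ such that the unique representation $\overline T:\mathcal M_l(E)\to B(X)$ with $\overline T\circ\lambda=T$ satisfies $\overline T\circ k_A=\pi$ and $\overline T\circ k_G=U$. Then there is a unique topological algebra isomorphism $\psi:(A\rtimes_\alpha G)^{\mathcal R}\to E$ such that the induced map $\psi_l(L)=\psi L\psi^{-1}$ from $\mathcal M_l((A\rtimes_\alpha G)^{\mathcal R})$ to $\mathcal M_l(E)$ satisfies $k_A=\psi_l\circ i_A^{\mathcal R}$ and $k_G=\psi_l\circ i_G^{\mathcal R}$. Moreover, $\psi$ is bipositive. -/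

import Mathlib

open MeasureTheory Topology Filter
open scoped CompactlySupported

universe u v w x

set_option linter.unusedSectionVars false

namespace OrderedCrossedProduct

noncomputable section

/-! ## Positive maps, approximate identities, left centralizers -/

/-- The natural operator cone: `T` maps the cone `C` into the cone `D`. -/
def MapsCone {X Y : Type*} [NormedAddCommGroup X] [NormedSpace ℝ X]
    [NormedAddCommGroup Y] [NormedSpace ℝ Y]
    (C : PointedCone ℝ X) (D : PointedCone ℝ Y) (T : X →L[ℝ] Y) : Prop :=
  ∀ y ∈ C, T y ∈ D

/-- A positive bounded approximate left identity of a Banach algebra `A` with cone `C`. The net is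
given through its filter of tails, pushed forward to `A`. -/
def HasPosBddApproxLeftId {A : Type*} [NonUnitalNormedRing A] [NormedSpace ℝ A]
    (C : PointedCone ℝ A) : Prop :=
  ∃ l : Filter A, l.NeBot ∧ (∃ M : ℝ, ∀ᶠ e in l, e ∈ C ∧ ‖e‖ ≤ M) ∧
    ∀ a : A, Tendsto (fun e => e * a) l (𝓝 a)

/-- The left centralizer algebra: bounded operators `L` with `L (a * b) = L a * b`. -/
def leftCentralizers (E : Type*) [NonUnitalNormedRing E] [NormedSpace ℝ E] [IsScalarTower ℝ E E] :
    Subalgebra ℝ (E →L[ℝ] E) where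
  carrier := {L | ∀ a b : E, L (a * b) = L a * b}
  mul_mem' {L M} hL hM a b := by
    change L (M (a * b)) = L (M a) * b
    rw [hM a b, hL]
  add_mem' {L M} hL hM a b := by simp [hM a b, hL a b, add_mul]
  algebraMap_mem' r a b := by simp [Algebra.algebraMap_eq_smul_one, smul_mul_assoc]

/-- The left regular representation `λ : E → M_l(E)`, `λ(a) b = a * b`. -/
def leftReg (E : Type*) [NonUnitalNormedRing E] [NormedSpace ℝ E] [IsScalarTower ℝ E E]
    [SMulCommClass ℝ E E] (a : E) : leftCentralizers E :=
  ⟨ContinuousLinearMap.mul ℝ E a, fun b c => by simp [mul_assoc]⟩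

/-- A representation of `A` by bounded operators on `X` is non-degenerate if the linear span of
`{π(a) x}` is dense. -/
def NonDegenerate {A : Type*} [NonUnitalNormedRing A] [NormedSpace ℝ A]
    {X : Type*} [NormedAddCommGroup X] [NormedSpace ℝ X] (π : A →ₙₐ[ℝ] (X →L[ℝ] X)) : Prop :=
  Dense (Submodule.span ℝ {y : X | ∃ (a : A) (z : X), y = π a z} : Set X)

/-- Boundedness of a representation. -/
def BoundedRep {A : Type*} [NonUnitalNormedRing A] [NormedSpace ℝ A]
    {X : Type*} [NormedAddCommGroup X] [NormedSpace ℝ X] (π : A →ₙₐ[ℝ] (X →L[ℝ] X)) : Prop :=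
  ∃ C : ℝ, ∀ a, ‖π a‖ ≤ C * ‖a‖

/-! ## Dynamical systems and covariant representations -/

/-- The action `α` of a Banach algebra dynamical system `(A, G, α)`: a strongly continuous
homomorphism of `G` into the group of bounded automorphisms of the Banach algebra `A`. -/
structure DynSys (A : Type u) (G : Type v) [NonUnitalNormedRing A] [NormedSpace ℝ A]
    [Group G] [TopologicalSpace G] where
  act : G →* (A →L[ℝ] A)ˣ
  act_mul : ∀ (s : G) (a b : A),
    (act s : A →L[ℝ] A) (a * b) = (act s : A →L[ℝ] A) a * (act s : A →L[ℝ] A) b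
  act_cont : ∀ a : A, Continuous fun s => (act s : A →L[ℝ] A) a

/-- All `α_s` are positive. Since `s` ranges over a group, all `α_s⁻¹ = α_{s⁻¹}` are positive,
too. -/
def DynSys.IsPositive {A : Type u} {G : Type v} [NonUnitalNormedRing A] [NormedSpace ℝ A]
    [Group G] [TopologicalSpace G] (α : DynSys A G) (Apos : PointedCone ℝ A) : Prop :=
  ∀ s, MapsCone Apos Apos (α.act s : A →L[ℝ] A)

/-- A continuous covariant representation `(π, U)` of `(A, G, α)` on `X`: `π` is bounded, `U` is
strongly continuous. -/
structure CovRep {A : Type u} {G : Type v} [NonUnitalNormedRing A] [NormedSpace ℝ A]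
    [Group G] [TopologicalSpace G] (α : DynSys A G)
    (X : Type w) [NormedAddCommGroup X] [NormedSpace ℝ X] where
  π : A →ₙₐ[ℝ] (X →L[ℝ] X)
  U : G →* (X →L[ℝ] X)ˣ
  covariant : ∀ (s : G) (a : A), π ((α.act s : A →L[ℝ] A) a) =
    (U s : X →L[ℝ] X) * π a * ((U s)⁻¹ : (X →L[ℝ] X)ˣ)
  bounded : BoundedRep π
  strongCont : ∀ y : X, Continuous fun s => (U s : X →L[ℝ] X) y

/-- `(π, U)` is positive. Since `s` ranges over a group, the operators `U_s⁻¹` are positive,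
too. -/
def CovRep.IsPositive {A : Type u} {G : Type v} [NonUnitalNormedRing A] [NormedSpace ℝ A]
    [Group G] [TopologicalSpace G] {α : DynSys A G} {X : Type w} [NormedAddCommGroup X]
    [NormedSpace ℝ X] (ρ : CovRep α X) (Apos : PointedCone ℝ A) (Xpos : PointedCone ℝ X) : Prop :=
  (∀ a ∈ Apos, MapsCone Xpos Xpos (ρ.π a)) ∧ ∀ s, MapsCone Xpos Xpos (ρ.U s : X →L[ℝ] X)

/-- A continuous covariant representation together with the pre-ordered Banach space on which it
acts. (A Banach space without order is one with cone `⊥ = {0}`.) -/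
structure BanachCovRep {A : Type u} {G : Type v} [NonUnitalNormedRing A] [NormedSpace ℝ A]
    [Group G] [TopologicalSpace G] (α : DynSys A G) where
  X : Type w
  [normed : NormedAddCommGroup X]
  [space : NormedSpace ℝ X]
  [complete : CompleteSpace X]
  cone : PointedCone ℝ X
  rep : CovRep α X

attribute [instance] BanachCovRep.normed BanachCovRep.space BanachCovRep.complete

/-- A (non-empty) uniformly bounded class of continuous covariant representations on Banach
spaces. -/
structure UnifBddClass {A : Type u} {G : Type v} [NonUnitalNormedRing A] [NormedSpace ℝ A]
    [Group G] [TopologicalSpace G] (α : DynSys A G) where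
  reps : Set (BanachCovRep.{u, v, w} α)
  nonempty : reps.Nonempty
  unifBdd : ∃ (C : ℝ) (ν : G → ℝ), 0 ≤ C ∧ (∀ r, 0 ≤ ν r) ∧
    (∀ K : Set G, IsCompact K → BddAbove (ν '' K)) ∧
    ∀ ρ ∈ reps, (∀ a, ‖ρ.rep.π a‖ ≤ C * ‖a‖) ∧ ∀ r, ‖(ρ.rep.U r : ρ.X →L[ℝ] ρ.X)‖ ≤ ν r

/-! ## Strongly continuous representations -/

section Basic

variable {G : Type v} [Group G] [TopologicalSpace G]
variable {X : Type w} [NormedAddCommGroup X] [NormedSpace ℝ X] [CompleteSpace X]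

theorem exists_bound_on_compact (U : G →* (X →L[ℝ] X)ˣ)
    (hU : ∀ y : X, Continuous fun s => (U s : X →L[ℝ] X) y) {K : Set G} (hK : IsCompact K) :
    ∃ M : ℝ, 0 ≤ M ∧ ∀ s ∈ K, ‖(U s : X →L[ℝ] X)‖ ≤ M := by
  obtain ⟨M, hM⟩ := banach_steinhaus (g := fun s : K => (U s : X →L[ℝ] X)) (fun y => by
    obtain ⟨C, hC⟩ := hK.exists_bound_of_continuousOn (hU y).continuousOn
    exact ⟨C, fun s => hC s s.2⟩)
  exact ⟨max M 0, le_max_right _ _, fun s hs => (hM ⟨s, hs⟩).trans (le_max_left _ _)⟩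

theorem continuous_joint [LocallyCompactSpace G] (U : G →* (X →L[ℝ] X)ˣ)
    (hU : ∀ y : X, Continuous fun s => (U s : X →L[ℝ] X) y) :
    Continuous fun p : G × X => (U p.1 : X →L[ℝ] X) p.2 := by
  rw [continuous_iff_continuousAt]
  rintro ⟨s₀, x₀⟩
  obtain ⟨K, hK, hKs⟩ := exists_compact_mem_nhds s₀
  obtain ⟨M, hM0, hM⟩ := exists_bound_on_compact U hU hK
  rw [ContinuousAt, tendsto_iff_norm_sub_tendsto_zero]
  have h1 : Tendsto (fun p : G × X => M * ‖p.2 - x₀‖ +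
      ‖(U p.1 : X →L[ℝ] X) x₀ - (U s₀ : X →L[ℝ] X) x₀‖) (𝓝 (s₀, x₀)) (𝓝 0) := by
    have hc : Continuous (fun p : G × X => M * ‖p.2 - x₀‖ +
      ‖(U p.1 : X →L[ℝ] X) x₀ - (U s₀ : X →L[ℝ] X) x₀‖) := by
      have := (hU x₀).comp (continuous_fst (X := G) (Y := X))
      simp only [Function.comp_def] at this
      fun_prop
    have := hc.tendsto (s₀, x₀)
    simpa using this
  refine squeeze_zero' (Eventually.of_forall fun _ => norm_nonneg _) ?_ h1
  have hmem : ∀ᶠ p : G × X in 𝓝 (s₀, x₀), p.1 ∈ K := continuous_fst.continuousAt hKs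
  filter_upwards [hmem] with p hp
  calc ‖(U p.1 : X →L[ℝ] X) p.2 - (U s₀ : X →L[ℝ] X) x₀‖
      = ‖(U p.1 : X →L[ℝ] X) (p.2 - x₀) +
          ((U p.1 : X →L[ℝ] X) x₀ - (U s₀ : X →L[ℝ] X) x₀)‖ := by
        rw [map_sub]; congr 1; abel
    _ ≤ ‖(U p.1 : X →L[ℝ] X) (p.2 - x₀)‖ + _ := norm_add_le _ _
    _ ≤ _ := by
        gcongr
        exact ((U p.1 : X →L[ℝ] X).le_opNorm _).trans (by gcongr; exact hM _ hp)

end Basic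

/-! ## Twisted convolution and integrated forms -/

section Main

variable {A : Type u} {G : Type v} [NonUnitalNormedRing A] [NormedSpace ℝ A] [IsScalarTower ℝ A A]
  [SMulCommClass ℝ A A] [CompleteSpace A]
  [Group G] [TopologicalSpace G] [IsTopologicalGroup G] [LocallyCompactSpace G]
  [MeasurableSpace G] [BorelSpace G]
  {α : DynSys A G} (μ : Measure G) [μ.IsHaarMeasure]

theorem twistedConv_integrand_continuous (f g : C_c(G, A)) :
    Continuous fun p : G × G => f p.2 * (α.act p.2 : A →L[ℝ] A) (g (p.2⁻¹ * p.1)) := by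
  have h := (continuous_joint α.act α.act_cont).comp
    (Continuous.prodMk (continuous_snd (X := G) (Y := G))
      (g.continuous.comp (continuous_snd.inv.mul continuous_fst)))
  exact (f.continuous.comp continuous_snd).mul h

/-- Twisted convolution `(f * g)(s) = ∫ f(r) α_r(g(r⁻¹ s)) dr`. -/
def twistedConv (f g : C_c(G, A)) : C_c(G, A) where
  toFun s := ∫ r, f r * (α.act r : A →L[ℝ] A) (g (r⁻¹ * s)) ∂μ
  continuous_toFun := by
    rw [← continuousOn_univ]
    refine continuousOn_integral_of_compact_support f.hasCompactSupport
      (twistedConv_integrand_continuous f g).continuousOn fun p r _ hr => ?_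
    simp [image_eq_zero_of_notMem_tsupport hr]
  hasCompactSupport' := by
    refine HasCompactSupport.intro (f.hasCompactSupport.mul g.hasCompactSupport) fun s hs => ?_
    refine integral_eq_zero_of_ae (Eventually.of_forall fun r => ?_)
    by_cases hr : r ∈ tsupport f
    · have : r⁻¹ * s ∉ tsupport g := fun h => hs ⟨r, hr, r⁻¹ * s, h, by simp⟩
      simp [image_eq_zero_of_notMem_tsupport this]
    · simp [image_eq_zero_of_notMem_tsupport hr]

section Rep

variable {X : Type w} [NormedAddCommGroup X] [NormedSpace ℝ X] [CompleteSpace X]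

theorem CovRep.continuous_π (ρ : CovRep α X) : Continuous ρ.π := by
  obtain ⟨C, hC⟩ := ρ.bounded
  exact (LinearMap.mkContinuousOfExistsBound
    ({ toFun := ρ.π, map_add' := map_add ρ.π, map_smul' := map_smul ρ.π } :
      A →ₗ[ℝ] (X →L[ℝ] X)) ⟨C, hC⟩).continuous

theorem CovRep.integrand_continuous (ρ : CovRep α X) (f : C_c(G, A)) (y : X) :
    Continuous fun r => ρ.π (f r) ((ρ.U r : X →L[ℝ] X) y) :=
  (ρ.continuous_π.comp f.continuous).clm_apply (ρ.strongCont y)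

theorem CovRep.integrand_integrable (ρ : CovRep α X) (f : C_c(G, A)) (y : X) :
    Integrable (fun r => ρ.π (f r) ((ρ.U r : X →L[ℝ] X) y)) μ := by
  refine (ρ.integrand_continuous f y).integrable_of_hasCompactSupport ?_
  refine HasCompactSupport.intro f.hasCompactSupport fun r hr => ?_
  simp [image_eq_zero_of_notMem_tsupport hr]

theorem CovRep.norm_integral_le (ρ : CovRep α X) (f : C_c(G, A)) {C M : ℝ} (hC : 0 ≤ C)
    (hπ : ∀ a, ‖ρ.π a‖ ≤ C * ‖a‖) (hU : ∀ r ∈ tsupport f, ‖(ρ.U r : X →L[ℝ] X)‖ ≤ M) (y : X) :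
    ‖∫ r, ρ.π (f r) ((ρ.U r : X →L[ℝ] X) y) ∂μ‖ ≤ (∫ r, C * ‖f r‖ * M ∂μ) * ‖y‖ := by
  have hi : Integrable (fun r => C * ‖f r‖ * M) μ := by
    refine Integrable.mul_const (Integrable.const_mul ?_ C) M
    exact (f.continuous.integrable_of_hasCompactSupport f.hasCompactSupport).norm
  rw [← integral_mul_const]
  refine norm_integral_le_of_norm_le (hi.mul_const _) (Eventually.of_forall fun r => ?_)
  by_cases hr : r ∈ tsupport f
  · calc ‖ρ.π (f r) ((ρ.U r : X →L[ℝ] X) y)‖ ≤ ‖ρ.π (f r)‖ * ‖(ρ.U r : X →L[ℝ] X) y‖ :=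
        (ρ.π (f r)).le_opNorm _
      _ ≤ (C * ‖f r‖) * (M * ‖y‖) := by
        gcongr
        · exact hπ _
        · exact ((ρ.U r : X →L[ℝ] X).le_opNorm _).trans (by gcongr; exact hU r hr)
      _ = _ := by ring
  · simp [image_eq_zero_of_notMem_tsupport hr]

/-- The integrated form `(π ⋊ U)(f) y = ∫ π(f(r)) U_r y dr`. -/
def CovRep.integratedForm (ρ : CovRep α X) (f : C_c(G, A)) : X →L[ℝ] X :=
  LinearMap.mkContinuousOfExistsBound
    { toFun := fun y => ∫ r, ρ.π (f r) ((ρ.U r : X →L[ℝ] X) y) ∂μ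
      map_add' := fun y z => by
        simp only [map_add]
        exact integral_add (ρ.integrand_integrable μ f y) (ρ.integrand_integrable μ f z)
      map_smul' := fun c y => by
        simp only [map_smul, RingHom.id_apply]
        exact integral_smul c _ } (by
    obtain ⟨C, hC⟩ := ρ.bounded
    obtain ⟨M, -, hM⟩ := exists_bound_on_compact ρ.U ρ.strongCont f.hasCompactSupport.isCompact
    exact ⟨_, ρ.norm_integral_le μ f (le_max_right C 0)
      (fun a => (hC a).trans (by gcongr; exact le_max_left _ _)) hM⟩)

theorem CovRep.integratedForm_apply (ρ : CovRep α X) (f : C_c(G, A)) (y : X) :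
    ρ.integratedForm μ f y = ∫ r, ρ.π (f r) ((ρ.U r : X →L[ℝ] X) y) ∂μ := rfl

theorem CovRep.integratedForm_add (ρ : CovRep α X) (f g : C_c(G, A)) :
    ρ.integratedForm μ (f + g) = ρ.integratedForm μ f + ρ.integratedForm μ g := by
  ext y
  simp only [integratedForm_apply, _root_.add_apply,
    CompactlySupportedContinuousMap.add_apply, map_add]
  exact integral_add (ρ.integrand_integrable μ f y) (ρ.integrand_integrable μ g y)

theorem CovRep.integratedForm_smul (ρ : CovRep α X) (c : ℝ) (f : C_c(G, A)) :
    ρ.integratedForm μ (c • f) = c • ρ.integratedForm μ f := by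
  ext y
  simp only [integratedForm_apply, _root_.smul_apply,
    CompactlySupportedContinuousMap.smul_apply, map_smul]
  exact integral_smul c _

theorem CovRep.integratedForm_sub (ρ : CovRep α X) (f g : C_c(G, A)) :
    ρ.integratedForm μ (f - g) = ρ.integratedForm μ f - ρ.integratedForm μ g := by
  have h : f - g = f + (-1 : ℝ) • g := by ext; simp [sub_eq_add_neg]
  rw [h, integratedForm_add, integratedForm_smul]; simp [sub_eq_add_neg]

theorem CovRep.norm_integratedForm_le (ρ : CovRep α X) (f : C_c(G, A)) {C M : ℝ} (hC : 0 ≤ C)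
    (hM0 : 0 ≤ M) (hπ : ∀ a, ‖ρ.π a‖ ≤ C * ‖a‖)
    (hU : ∀ r ∈ tsupport f, ‖(ρ.U r : X →L[ℝ] X)‖ ≤ M) :
    ‖ρ.integratedForm μ f‖ ≤ ∫ r, C * ‖f r‖ * M ∂μ :=
  ContinuousLinearMap.opNorm_le_bound _ (integral_nonneg fun r => by positivity)
    (ρ.norm_integral_le μ f hC hπ hU)

/-- The integrated form is multiplicative. -/
theorem CovRep.integratedForm_conv (ρ : CovRep α X) (f g : C_c(G, A)) :
    ρ.integratedForm μ (twistedConv (α := α) μ f g) =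
      ρ.integratedForm μ f * ρ.integratedForm μ g := by
  ext y
  obtain ⟨C, hC⟩ := ρ.bounded
  let P : A →L[ℝ] (X →L[ℝ] X) := LinearMap.mkContinuousOfExistsBound
    ({ toFun := ρ.π, map_add' := map_add ρ.π, map_smul' := map_smul ρ.π } :
      A →ₗ[ℝ] (X →L[ℝ] X)) ⟨C, hC⟩
  have hP : ∀ a, P a = ρ.π a := fun _ => rfl
  let F : G → G → X := fun s r => ρ.π (f r * (α.act r : A →L[ℝ] A) (g (r⁻¹ * s)))
    ((ρ.U s : X →L[ℝ] X) y)
  have hFc : Continuous F.uncurry :=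
    (ρ.continuous_π.comp (twistedConv_integrand_continuous (α := α) f g)).clm_apply
      ((ρ.strongCont y).comp continuous_fst)
  have hFs : HasCompactSupport F.uncurry := by
    refine HasCompactSupport.intro
      ((f.hasCompactSupport.mul g.hasCompactSupport).prod f.hasCompactSupport) ?_
    rintro ⟨s, r⟩ hs
    by_cases hr : r ∈ tsupport f
    · have : r⁻¹ * s ∉ tsupport g := fun h =>
        hs ⟨⟨r, hr, r⁻¹ * s, h, by simp⟩, hr⟩
      simp [F, Function.uncurry, image_eq_zero_of_notMem_tsupport this]
    · simp [F, Function.uncurry, image_eq_zero_of_notMem_tsupport hr]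
  have h1 : ∀ s, ρ.π (twistedConv (α := α) μ f g s) ((ρ.U s : X →L[ℝ] X) y) = ∫ r, F s r ∂μ := by
    intro s
    have hint : Integrable (fun r => f r * (α.act r : A →L[ℝ] A) (g (r⁻¹ * s))) μ := by
      refine Continuous.integrable_of_hasCompactSupport
        ((twistedConv_integrand_continuous (α := α) f g).comp
          (Continuous.prodMk continuous_const continuous_id)) ?_
      refine HasCompactSupport.intro f.hasCompactSupport fun r hr => ?_
      simp [image_eq_zero_of_notMem_tsupport hr]
    exact (((ContinuousLinearMap.apply ℝ X ((ρ.U s : X →L[ℝ] X) y)).comp P).integral_comp_comm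
      hint).symm
  have h2 : ∀ r s, F s r = (ρ.π (f r) * (ρ.U r : X →L[ℝ] X))
      (ρ.π (g (r⁻¹ * s)) ((ρ.U (r⁻¹ * s) : X →L[ℝ] X) y)) := by
    intro r s
    simp only [F, map_mul, ρ.covariant, _root_.mul_apply_eq_comp, map_inv, Units.val_mul]
  rw [integratedForm_apply, _root_.mul_apply_eq_comp, integratedForm_apply]
  simp_rw [h1]
  rw [integral_integral_swap_of_hasCompactSupport hFc hFs]
  refine integral_congr_ae (Eventually.of_forall fun r => ?_)
  simp only [h2]
  rw [integral_mul_left_eq_self (μ := μ) (fun s => (ρ.π (f r) * (ρ.U r : X →L[ℝ] X))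
      (ρ.π (g s) ((ρ.U s : X →L[ℝ] X) y))) r⁻¹,
    ContinuousLinearMap.integral_comp_comm _ (ρ.integrand_integrable μ g y),
    integratedForm_apply, _root_.mul_apply_eq_comp]

end Rep

/-! ## The operators `i_A(a)` and `i_G(r)` on `C_c(G, A)` -/

/-- `(i_A(a) f)(s) = a f(s)`. -/
def preIA (a : A) (f : C_c(G, A)) : C_c(G, A) where
  toFun s := a * f s
  continuous_toFun := continuous_const.mul f.continuous
  hasCompactSupport' := f.hasCompactSupport.mul_left

/-- `(i_G(r) f)(s) = α_r (f (r⁻¹ s))`. -/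
def preIG (α : DynSys A G) (r : G) (f : C_c(G, A)) : C_c(G, A) where
  toFun s := (α.act r : A →L[ℝ] A) (f (r⁻¹ * s))
  continuous_toFun :=
    (α.act r : A →L[ℝ] A).continuous.comp (f.continuous.comp (continuous_const.mul continuous_id))
  hasCompactSupport' := by
    refine HasCompactSupport.intro (f.hasCompactSupport.isCompact.image (continuous_const_mul r))
      fun s hs => ?_
    have : r⁻¹ * s ∉ tsupport f := fun h => hs ⟨_, h, by simp⟩
    simp [image_eq_zero_of_notMem_tsupport this]

theorem CovRep.integratedForm_preIA {X : Type w} [NormedAddCommGroup X] [NormedSpace ℝ X]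
    [CompleteSpace X] (ρ : CovRep α X) (a : A) (f : C_c(G, A)) :
    ρ.integratedForm μ (preIA a f) = ρ.π a * ρ.integratedForm μ f := by
  ext y
  rw [_root_.mul_apply_eq_comp, integratedForm_apply, integratedForm_apply,
    ← ContinuousLinearMap.integral_comp_comm _ (ρ.integrand_integrable μ f y)]
  refine integral_congr_ae (Eventually.of_forall fun s => ?_)
  change ρ.π (a * f s) _ = _
  simp

theorem CovRep.integratedForm_preIG {X : Type w} [NormedAddCommGroup X] [NormedSpace ℝ X]
    [CompleteSpace X] (ρ : CovRep α X) (r : G) (f : C_c(G, A)) :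
    ρ.integratedForm μ (preIG α r f) = (ρ.U r : X →L[ℝ] X) * ρ.integratedForm μ f := by
  ext y
  rw [_root_.mul_apply_eq_comp, integratedForm_apply, integratedForm_apply,
    ← ContinuousLinearMap.integral_comp_comm _ (ρ.integrand_integrable μ f y),
    ← integral_mul_left_eq_self (μ := μ)
      (fun s => (ρ.U r : X →L[ℝ] X) (ρ.π (f s) ((ρ.U s : X →L[ℝ] X) y))) r⁻¹]
  refine integral_congr_ae (Eventually.of_forall fun s => ?_)
  change ρ.π ((α.act r : A →L[ℝ] A) (f (r⁻¹ * s))) _ = _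
  simp [ρ.covariant]

/-! ## The seminorm `σ^R` and the crossed product -/

namespace UnifBddClass

variable (R : UnifBddClass.{u, v, w} α)

theorem bddAbove (f : C_c(G, A)) :
    BddAbove (Set.range fun ρ : R.reps => ‖ρ.1.rep.integratedForm μ f‖) := by
  obtain ⟨C, ν, hC, hν, hK, h⟩ := R.unifBdd
  obtain ⟨M, hM⟩ := hK _ f.hasCompactSupport.isCompact
  refine ⟨∫ r, C * ‖f r‖ * max M 0 ∂μ, ?_⟩
  rintro _ ⟨ρ, rfl⟩
  exact ρ.1.rep.norm_integratedForm_le μ f hC (le_max_right _ _) (h _ ρ.2).1 fun r hr =>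
    ((h _ ρ.2).2 r).trans ((hM ⟨r, hr, rfl⟩).trans (le_max_left _ _))

instance : Nonempty R.reps := R.nonempty.to_subtype

/-- `σ^R(f)`, the supremum of `‖(π ⋊ U)(f)‖` over all `(π, U)` in the class `R`. -/
def sigma : Seminorm ℝ C_c(G, A) :=
  Seminorm.of (fun f => ⨆ ρ : R.reps, ‖ρ.1.rep.integratedForm μ f‖)
    (fun f g => ciSup_le fun ρ => by
      rw [CovRep.integratedForm_add]
      exact (norm_add_le _ _).trans
        (add_le_add (le_ciSup (R.bddAbove μ f) ρ) (le_ciSup (R.bddAbove μ g) ρ)))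
    (fun c f => by
      simp only [CovRep.integratedForm_smul, norm_smul]
      exact (Real.mul_iSup_of_nonneg (norm_nonneg c) _).symm)

theorem sigma_apply (f : C_c(G, A)) :
    R.sigma μ f = ⨆ ρ : R.reps, ‖ρ.1.rep.integratedForm μ f‖ := rfl

theorem norm_le_sigma (ρ : R.reps) (f : C_c(G, A)) :
    ‖ρ.1.rep.integratedForm μ f‖ ≤ R.sigma μ f :=
  le_ciSup (R.bddAbove μ f) ρ

theorem sigma_conv_le (f g : C_c(G, A)) :
    R.sigma μ (twistedConv (α := α) μ f g) ≤ R.sigma μ f * R.sigma μ g :=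
  ciSup_le fun ρ => by
    rw [CovRep.integratedForm_conv]
    exact (norm_mul_le _ _).trans (mul_le_mul (R.norm_le_sigma μ ρ f) (R.norm_le_sigma μ ρ g)
      (norm_nonneg _) (apply_nonneg _ _))

theorem sigma_eq_zero {f : C_c(G, A)} (h : ∀ ρ ∈ R.reps, ρ.rep.integratedForm μ f = 0) :
    R.sigma μ f = 0 :=
  le_antisymm (ciSup_le fun ρ => by rw [h ρ.1 ρ.2, norm_zero]) (apply_nonneg _ _)

end UnifBddClass

variable (R : UnifBddClass.{u, v, w} α)

/-- `C_c(G, A)` as a seminormed space with the seminorm `σ^R`. -/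
@[nolint unusedArguments]
def PreCrossedProduct (_μ : Measure G) (_R : UnifBddClass.{u, v, w} α) : Type (max u v) := C_c(G, A)

namespace PreCrossedProduct

/-- The identity map `C_c(G, A) → PreCrossedProduct μ R`. -/
def of (f : C_c(G, A)) : PreCrossedProduct μ R := f

instance : SeminormedAddCommGroup (PreCrossedProduct μ R) :=
  AddGroupSeminorm.toSeminormedAddCommGroup (E := C_c(G, A)) (R.sigma μ).toAddGroupSeminorm

instance : Module ℝ (PreCrossedProduct μ R) := inferInstanceAs (Module ℝ C_c(G, A))

theorem norm_of (f : C_c(G, A)) : ‖of μ R f‖ = R.sigma μ f := rfl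

instance : NormedSpace ℝ (PreCrossedProduct μ R) where
  norm_smul_le c f := ((R.sigma μ).smul' c f).le

end PreCrossedProduct

/-- The crossed product `(A ⋊_α G)^R`: the (Hausdorff) completion of `C_c(G, A)` with respect to
the seminorm `σ^R`, that is, the completion of `C_c(G, A) / ker σ^R` with the norm induced by
`σ^R`. -/
def CrossedProduct : Type (max u v) := UniformSpace.Completion (PreCrossedProduct μ R)

namespace CrossedProduct

instance : NormedAddCommGroup (CrossedProduct μ R) :=
  inferInstanceAs (NormedAddCommGroup (UniformSpace.Completion (PreCrossedProduct μ R)))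

instance : NormedSpace ℝ (CrossedProduct μ R) :=
  inferInstanceAs (NormedSpace ℝ (UniformSpace.Completion (PreCrossedProduct μ R)))

instance : CompleteSpace (CrossedProduct μ R) :=
  inferInstanceAs (CompleteSpace (UniformSpace.Completion (PreCrossedProduct μ R)))

/-- The quotient map `q^R : C_c(G, A) → (A ⋊_α G)^R`. -/
def q : C_c(G, A) →ₗ[ℝ] CrossedProduct μ R where
  toFun f := ((PreCrossedProduct.of μ R f : PreCrossedProduct μ R) :
    UniformSpace.Completion (PreCrossedProduct μ R))
  map_add' f g := UniformSpace.Completion.coe_add (PreCrossedProduct.of μ R f)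
    (PreCrossedProduct.of μ R g)
  map_smul' c f := UniformSpace.Completion.coe_smul c (PreCrossedProduct.of μ R f)

theorem norm_q (f : C_c(G, A)) : ‖q μ R f‖ = R.sigma μ f :=
  UniformSpace.Completion.norm_coe (PreCrossedProduct.of μ R f)

theorem denseRange_q : DenseRange (q μ R) :=
  UniformSpace.Completion.denseRange_coe (α := PreCrossedProduct μ R)

theorem q_eq_q {f g : C_c(G, A)}
    (h : ∀ ρ ∈ R.reps, ρ.rep.integratedForm μ f = ρ.rep.integratedForm μ g) :
    q μ R f = q μ R g := by
  rw [← sub_eq_zero, ← map_sub, ← norm_eq_zero, norm_q]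
  refine R.sigma_eq_zero μ fun ρ hρ => ?_
  rw [CovRep.integratedForm_sub, h ρ hρ, sub_self]

/-- The bounded linear map `T^R` induced on the crossed product by a linear map `T` on `C_c(G, A)`
that is bounded with respect to `σ^R`. (Junk value if `T` is not bounded.) -/
def induced {Y : Type*} [NormedAddCommGroup Y] [NormedSpace ℝ Y] [CompleteSpace Y]
    (T : C_c(G, A) →ₗ[ℝ] Y) : CrossedProduct μ R →L[ℝ] Y :=
  T.extendOfNorm (q μ R)

theorem induced_q {Y : Type*} [NormedAddCommGroup Y] [NormedSpace ℝ Y] [CompleteSpace Y]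
    {T : C_c(G, A) →ₗ[ℝ] Y} (hT : ∃ C, ∀ f, ‖T f‖ ≤ C * R.sigma μ f) (f : C_c(G, A)) :
    induced μ R T (q μ R f) = T f :=
  LinearMap.extendOfNorm_eq (denseRange_q μ R) (by simpa only [norm_q] using hT) f

/-- `g ↦ q(f * g)`. -/
def convLeft (f : C_c(G, A)) : C_c(G, A) →ₗ[ℝ] CrossedProduct μ R where
  toFun g := q μ R (twistedConv (α := α) μ f g)
  map_add' g h := by
    rw [← map_add]
    refine q_eq_q μ R fun ρ _ => ?_
    simp only [CovRep.integratedForm_add, CovRep.integratedForm_conv, mul_add]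
  map_smul' c g := by
    rw [RingHom.id_apply, ← map_smul]
    refine q_eq_q μ R fun ρ _ => ?_
    simp only [CovRep.integratedForm_smul, CovRep.integratedForm_conv, mul_smul_comm]

theorem convLeft_le (f g : C_c(G, A)) : ‖convLeft μ R f g‖ ≤ R.sigma μ f * R.sigma μ g :=
  (norm_q μ R _).trans_le (R.sigma_conv_le μ f g)

theorem induced_convLeft (f g : C_c(G, A)) :
    induced μ R (convLeft μ R f) (q μ R g) = q μ R (twistedConv (α := α) μ f g) :=
  induced_q μ R ⟨_, convLeft_le μ R f⟩ g

theorem norm_induced_convLeft_le (f : C_c(G, A)) :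
    ‖induced μ R (convLeft μ R f)‖ ≤ R.sigma μ f :=
  LinearMap.opNorm_extendOfNorm_le (denseRange_q μ R) (apply_nonneg _ _)
    (by simpa only [norm_q] using convLeft_le μ R f)

/-- `f ↦ (q(g) ↦ q(f * g))`. -/
def convBilin : C_c(G, A) →ₗ[ℝ] (CrossedProduct μ R →L[ℝ] CrossedProduct μ R) where
  toFun f := induced μ R (convLeft μ R f)
  map_add' f g := by
    refine ContinuousLinearMap.coeFn_injective ((denseRange_q μ R).equalizer
      (ContinuousLinearMap.continuous _) (ContinuousLinearMap.continuous _) (funext fun h => ?_))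
    simp only [Function.comp_apply, _root_.add_apply, induced_convLeft]
    rw [← map_add]
    refine q_eq_q μ R fun ρ _ => ?_
    simp only [CovRep.integratedForm_add, CovRep.integratedForm_conv, add_mul]
  map_smul' c f := by
    refine ContinuousLinearMap.coeFn_injective ((denseRange_q μ R).equalizer
      (ContinuousLinearMap.continuous _) (ContinuousLinearMap.continuous _) (funext fun h => ?_))
    simp only [Function.comp_apply, RingHom.id_apply, _root_.smul_apply,
      induced_convLeft]
    rw [← map_smul]
    refine q_eq_q μ R fun ρ _ => ?_
    simp only [CovRep.integratedForm_smul, CovRep.integratedForm_conv, smul_mul_assoc]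

/-- The multiplication of the crossed product as a bounded bilinear map: the continuous extension
of twisted convolution. -/
def mulL : CrossedProduct μ R →L[ℝ] CrossedProduct μ R →L[ℝ] CrossedProduct μ R :=
  induced μ R (convBilin μ R)

theorem mulL_q (f g : C_c(G, A)) :
    mulL μ R (q μ R f) (q μ R g) = q μ R (twistedConv (α := α) μ f g) := by
  have h : mulL μ R (q μ R f) = convBilin μ R f :=
    induced_q μ R ⟨1, fun f => (norm_induced_convLeft_le μ R f).trans (one_mul _).ge⟩ f
  rw [h]
  exact induced_convLeft μ R f g

theorem norm_mulL_le : ‖mulL μ R‖ ≤ 1 :=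
  LinearMap.opNorm_extendOfNorm_le (denseRange_q μ R) zero_le_one fun f =>
    (norm_induced_convLeft_le μ R f).trans (by rw [norm_q, one_mul])

instance : Mul (CrossedProduct μ R) := ⟨fun x y => mulL μ R x y⟩

theorem mul_def (x y : CrossedProduct μ R) : x * y = mulL μ R x y := rfl

/-- The quotient map turns twisted convolution into multiplication. -/
theorem q_mul (f g : C_c(G, A)) :
    q μ R f * q μ R g = q μ R (twistedConv (α := α) μ f g) := mulL_q μ R f g

instance : NonUnitalNormedRing (CrossedProduct μ R) where
  __ := (inferInstance : NormedAddCommGroup (CrossedProduct μ R))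
  left_distrib x y z := by simp only [mul_def, map_add]
  right_distrib x y z := by simp only [mul_def, map_add, _root_.add_apply]
  zero_mul x := by simp only [mul_def, map_zero, _root_.zero_apply]
  mul_zero x := by simp only [mul_def, map_zero]
  mul_assoc x y z := by
    have hc : ∀ {S : Type (max u v)} [TopologicalSpace S] {a b : S → CrossedProduct μ R},
        Continuous a → Continuous b → Continuous fun s => mulL μ R (a s) (b s) :=
      fun ha hb => ((mulL μ R).continuous.comp ha).clm_apply hb
    refine DenseRange.induction_on₃ (denseRange_q μ R)
      (p := fun x y z => mulL μ R (mulL μ R x y) z = mulL μ R x (mulL μ R y z)) ?_ ?_ x y z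
    · exact isClosed_eq (hc (hc continuous_fst (continuous_fst.comp continuous_snd))
          (continuous_snd.comp continuous_snd))
        (hc continuous_fst (hc (continuous_fst.comp continuous_snd)
          (continuous_snd.comp continuous_snd)))
    · intro f g h
      simp only [mulL_q]
      refine q_eq_q μ R fun ρ _ => ?_
      simp only [CovRep.integratedForm_conv, mul_assoc]
  norm_mul_le x y := by
    refine ((mulL μ R).le_opNorm₂ x y).trans ?_
    have := norm_mulL_le μ R
    calc ‖mulL μ R‖ * ‖x‖ * ‖y‖ ≤ 1 * ‖x‖ * ‖y‖ := by gcongr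
      _ = ‖x‖ * ‖y‖ := by rw [one_mul]

instance : IsScalarTower ℝ (CrossedProduct μ R) (CrossedProduct μ R) :=
  ⟨fun c x y => by simp only [smul_eq_mul, mul_def, map_smul, _root_.smul_apply]⟩

instance : SMulCommClass ℝ (CrossedProduct μ R) (CrossedProduct μ R) :=
  ⟨fun c x y => by simp only [smul_eq_mul, mul_def, map_smul]⟩

/-- `q^R ∘ i_A(a)`. -/
def qIA (a : A) : C_c(G, A) →ₗ[ℝ] CrossedProduct μ R where
  toFun f := q μ R (preIA a f)
  map_add' f g := by
    rw [← map_add]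
    refine q_eq_q μ R fun ρ _ => ?_
    simp only [CovRep.integratedForm_add, CovRep.integratedForm_preIA, mul_add]
  map_smul' c f := by
    rw [RingHom.id_apply, ← map_smul]
    refine q_eq_q μ R fun ρ _ => ?_
    simp only [CovRep.integratedForm_smul, CovRep.integratedForm_preIA, mul_smul_comm]

/-- `q^R ∘ i_G(r)`. -/
def qIG (r : G) : C_c(G, A) →ₗ[ℝ] CrossedProduct μ R where
  toFun f := q μ R (preIG α r f)
  map_add' f g := by
    rw [← map_add]
    refine q_eq_q μ R fun ρ _ => ?_
    simp only [CovRep.integratedForm_add, CovRep.integratedForm_preIG, mul_add]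
  map_smul' c f := by
    rw [RingHom.id_apply, ← map_smul]
    refine q_eq_q μ R fun ρ _ => ?_
    simp only [CovRep.integratedForm_smul, CovRep.integratedForm_preIG, mul_smul_comm]

theorem induced_qIA (a : A) (f : C_c(G, A)) :
    induced μ R (qIA μ R a) (q μ R f) = q μ R (preIA a f) := by
  obtain ⟨C, ν, hC, -, -, h⟩ := R.unifBdd
  refine induced_q μ R (T := qIA μ R a) ⟨C * ‖a‖, fun f => ?_⟩ f
  refine (norm_q μ R _).trans_le (ciSup_le fun ρ => ?_)
  rw [CovRep.integratedForm_preIA]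
  exact (norm_mul_le _ _).trans (mul_le_mul ((h _ ρ.2).1 a) (R.norm_le_sigma μ ρ f)
    (norm_nonneg _) (by positivity))

theorem induced_qIG (r : G) (f : C_c(G, A)) :
    induced μ R (qIG μ R r) (q μ R f) = q μ R (preIG α r f) := by
  obtain ⟨C, ν, -, hν, -, h⟩ := R.unifBdd
  refine induced_q μ R (T := qIG μ R r) ⟨ν r, fun f => ?_⟩ f
  refine (norm_q μ R _).trans_le (ciSup_le fun ρ => ?_)
  rw [CovRep.integratedForm_preIG]
  exact (norm_mul_le _ _).trans (mul_le_mul ((h _ ρ.2).2 r) (R.norm_le_sigma μ ρ f)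
    (norm_nonneg _) (hν r))

theorem mem_leftCentralizers {L : CrossedProduct μ R →L[ℝ] CrossedProduct μ R}
    (h : ∀ f g : C_c(G, A), L (q μ R f * q μ R g) = L (q μ R f) * q μ R g) :
    L ∈ leftCentralizers (CrossedProduct μ R) := fun x y =>
  DenseRange.induction_on₂ (denseRange_q μ R) (p := fun x y => L (x * y) = L x * y)
    (isClosed_eq (L.continuous.comp (continuous_fst.mul continuous_snd))
      ((L.continuous.comp continuous_fst).mul continuous_snd)) h x y

/-- `i_A^R : A → M_l((A ⋊_α G)^R)`: the bounded operator `i_A^R(a)` on the crossed product is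
induced by `i_A(a)`. -/
def iA (a : A) : leftCentralizers (CrossedProduct μ R) :=
  ⟨induced μ R (qIA μ R a), mem_leftCentralizers μ R fun f g => by
    rw [q_mul, induced_qIA, induced_qIA, q_mul]
    refine q_eq_q μ R fun ρ _ => ?_
    simp only [CovRep.integratedForm_preIA, CovRep.integratedForm_conv, mul_assoc]⟩

/-- `i_G^R : G → M_l((A ⋊_α G)^R)`: the bounded operator `i_G^R(r)` on the crossed product is
induced by `i_G(r)`. -/
def iG (r : G) : leftCentralizers (CrossedProduct μ R) :=
  ⟨induced μ R (qIG μ R r), mem_leftCentralizers μ R fun f g => by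
    rw [q_mul, induced_qIG, induced_qIG, q_mul]
    refine q_eq_q μ R fun ρ _ => ?_
    simp only [CovRep.integratedForm_preIG, CovRep.integratedForm_conv, mul_assoc]⟩

/-- The cone of the pre-ordered crossed product: the closure of `q^R(C_c(G, A₊))`. -/
def cone (Apos : PointedCone ℝ A) : PointedCone ℝ (CrossedProduct μ R) :=
  PointedCone.closure
    { carrier := {d | ∃ f : C_c(G, A), (∀ s, f s ∈ Apos) ∧ q μ R f = d}
      zero_mem' := ⟨0, fun _ => Apos.zero_mem, map_zero _⟩
      add_mem' := by
        rintro _ _ ⟨f, hf, rfl⟩ ⟨g, hg, rfl⟩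
        exact ⟨f + g, fun s => Apos.add_mem (hf s) (hg s), map_add _ _ _⟩
      smul_mem' := by
        rintro c _ ⟨f, hf, rfl⟩
        exact ⟨c.1 • f, fun s => Apos.smul_mem c.2 (hf s), map_smul _ _ _⟩ }

end CrossedProduct

/-- A continuous covariant representation on a Banach space is `R`-continuous if its integrated
form is bounded with respect to `σ^R`. -/
def CovRep.IsContinuousWrt {X : Type x} [NormedAddCommGroup X] [NormedSpace ℝ X] [CompleteSpace X]
    (ρ : CovRep α X) : Prop :=
  ∃ M : ℝ, ∀ f : C_c(G, A), ‖ρ.integratedForm μ f‖ ≤ M * R.sigma μ f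

/-- `ψ` is a topological isomorphism of algebras, and the induced map `ψ_l(L) = ψ ∘ L ∘ ψ⁻¹` of the
left centralizer algebras carries the pair `(i_A^R, i_G^R)` to `(k_A, k_G)`. -/
structure CrossedProduct.IsIntertwiner {E : Type x} [NonUnitalNormedRing E] [NormedSpace ℝ E]
    (k : CovRep α E) (ψ : CrossedProduct μ R ≃L[ℝ] E) : Prop where
  map_mul : ∀ c d, ψ (c * d) = ψ c * ψ d
  map_iA : ∀ a, k.π a = (ψ : CrossedProduct μ R →L[ℝ] E) ∘L
    (CrossedProduct.iA μ R a : CrossedProduct μ R →L[ℝ] CrossedProduct μ R) ∘L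
    (ψ.symm : E →L[ℝ] CrossedProduct μ R)
  map_iG : ∀ r, (k.U r : E →L[ℝ] E) = (ψ : CrossedProduct μ R →L[ℝ] E) ∘L
    (CrossedProduct.iG μ R r : CrossedProduct μ R →L[ℝ] CrossedProduct μ R) ∘L
    (ψ.symm : E →L[ℝ] CrossedProduct μ R)

end Main

end

end OrderedCrossedProduct

open OrderedCrossedProduct

namespace OrderedCrossedProduct

open scoped ENNReal

/-! By `h2` and the injectivity of λ, each f in C_c(G, A) determines an element Λ f of E with λ(Λ f)
= (k_A ⋊ k_G)(f). The heart of the proof is that ‖Λ f‖ and σ^R(f) are equivalent. Then Λ extends to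
a bounded operator on the crossed product that is bounded below, hence injective with closed range,
and `h3` makes it onto.

The bound of ‖Λ f‖ by σ^R(f) is the R-continuity of (k_A, k_G), as λ is bounded below. The reverse
bound needs the generating property for just one representation: an ℓ¹-direct sum of almost norming
members of R, whose integrated form dominates σ^R up to a factor 2
(`UnifBddClass.exists_bounded_below`). The operator T(Λ f) attached to it is its integrated form at
f (`CovRep.rep_eq_integratedForm`), so σ^R(f) is at most a constant times ‖Λ f‖.

Products and the intertwining relations are checked on the dense image of C_c(G, A), after applying
λ. Bipositivity combines the closedness of the cone of E with `h4`. For uniqueness, θ = φψ⁻¹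
commutes with every λ(e) and is multiplicative, so θ(e)θ(c) = eθ(c) for all c, and injectivity of λ
gives θ(e) = e. -/

/-- The integral of a function with values in a closed cone lies in the cone. -/
theorem integral_mem_closedCone {S : Type*} [MeasurableSpace S] {μ : Measure S}
    {X : Type*} [NormedAddCommGroup X] [NormedSpace ℝ X] [CompleteSpace X]
    (D : PointedCone ℝ X) (hD : IsClosed (D : Set X)) {F : S → X} (hF : Integrable F μ)
    (hmem : ∀ s, F s ∈ D) : ∫ s, F s ∂μ ∈ D := by
  by_contra hnot
  -- Hahn–Banach: some functional is nonnegative on the cone and negative at the integral. No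
  -- finiteness of the measure is needed.
  obtain ⟨f, hf, hlt⟩ := ProperCone.hyperplane_separation_point
    (⟨D, hD⟩ : ProperCone ℝ X) (x₀ := ∫ s, F s ∂μ) hnot
  rw [← f.integral_comp_comm hF] at hlt
  exact hlt.not_ge (integral_nonneg fun s => hf _ (hmem s))

/-! ### ℓ¹-direct sums of pre-ordered spaces and of covariant representations. -/

section DirectSum

variable {ι : Type x} {Y : ι → Type w} [∀ i, NormedAddCommGroup (Y i)] [∀ i, NormedSpace ℝ (Y i)]

/-- The cone of an `ℓ¹`-direct sum of pre-ordered spaces, given coordinatewise. -/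
def lpCone (D : ∀ i, PointedCone ℝ (Y i)) : PointedCone ℝ (lp Y 1) :=
  { carrier := {y | ∀ i, y i ∈ D i}
    zero_mem' := fun i => (D i).zero_mem
    add_mem' := fun hy hz i => (D i).add_mem (hy i) (hz i)
    smul_mem' := fun c _ hy i => (D i).smul_mem c.2 (hy i) }

theorem mem_lpCone {D : ∀ i, PointedCone ℝ (Y i)} {y : lp Y 1} :
    y ∈ lpCone D ↔ ∀ i, y i ∈ D i := Iff.rfl

theorem isClosed_lpCone {D : ∀ i, PointedCone ℝ (Y i)} (hD : ∀ i, IsClosed (D i : Set (Y i))) :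
    IsClosed (lpCone D : Set (lp Y 1)) := by
  have : (lpCone D : Set (lp Y 1)) = ⋂ i, lp.evalCLM ℝ Y 1 i ⁻¹' (D i : Set (Y i)) := by
    ext y
    simp only [SetLike.mem_coe, mem_lpCone, Set.mem_iInter, Set.mem_preimage]
    rfl
  rw [this]
  exact isClosed_iInter fun i => (hD i).preimage (lp.evalCLM ℝ Y 1 i).continuous

/-- In ℓ¹ every element is the limit of its finite partial sums of single-coordinate elements. This
reduces strong continuity and non-degeneracy of a direct sum to one summand at a time. -/
theorem lp_closed_induction [DecidableEq ι] {p : lp Y 1 → Prop} (hzero : p 0)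
    (hadd : ∀ y z, p y → p z → p (y + z)) (hclosed : IsClosed {y | p y})
    (hsingle : ∀ i z, p (lp.single 1 i z)) (y : lp Y 1) : p y := by
  refine hclosed.mem_of_tendsto (lp.hasSum_single ENNReal.one_ne_top y)
    (Eventually.of_forall fun s => ?_)
  exact Finset.sum_induction _ p hadd hzero fun i _ => hsingle i _

theorem mapCLM_apply (T : ∀ i, Y i →L[ℝ] Y i) {K : ℝ} (hK : 0 ≤ K) (hT : ∀ i, ‖T i‖ ≤ K)
    (y : lp Y 1) (i : ι) : lp.mapCLM 1 T hK hT y i = T i (y i) := rfl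

theorem mapCLM_single [DecidableEq ι] (T : ∀ i, Y i →L[ℝ] Y i) {K : ℝ} (hK : 0 ≤ K)
    (hT : ∀ i, ‖T i‖ ≤ K) (i : ι) (z : Y i) :
    lp.mapCLM 1 T hK hT (lp.single 1 i z) = lp.single 1 i (T i z) := by
  ext j
  rw [mapCLM_apply]
  by_cases h : j = i
  · subst h; simp
  · simp [h]

variable {A : Type u} {G : Type v} [NonUnitalNormedRing A] [NormedSpace ℝ A]
  [Group G] [TopologicalSpace G] [LocallyCompactSpace G] {α : DynSys A G}

/-- The `ℓ¹`-direct sum of a uniformly bounded family of covariant representations. -/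
noncomputable def CovRep.directSum (ρ : ∀ i, CovRep α (Y i)) {C : ℝ} {ν : G → ℝ} (hC : 0 ≤ C)
    (hν : ∀ r, 0 ≤ ν r) (hνK : ∀ K : Set G, IsCompact K → BddAbove (ν '' K))
    (hπ : ∀ i a, ‖(ρ i).π a‖ ≤ C * ‖a‖)
    (hU : ∀ i r, ‖((ρ i).U r : Y i →L[ℝ] Y i)‖ ≤ ν r) : CovRep α (lp Y 1) where
  π :=
    { toFun a := lp.mapCLM 1 (fun i => (ρ i).π a) (by positivity) fun i => hπ i a
      map_smul' c a := by ext y i; simp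
      map_zero' := by ext y i; simp
      map_add' a b := by ext y i; simp
      map_mul' a b := by ext y i; simp }
  -- As G is a group, a monoid homomorphism into the operators takes invertible values, so no
  -- inverse has to be supplied.
  U := MonoidHom.toHomUnits
    { toFun r := lp.mapCLM 1 (fun i => ((ρ i).U r : Y i →L[ℝ] Y i)) (hν r) fun i => hU i r
      map_one' := by ext y i; simp
      map_mul' r s := by ext y i; simp }
  covariant s a := by
    -- Writing the inverse of U_s as U at s⁻¹ makes it act coordinatewise by definition.
    rw [← map_inv]
    ext y i
    change (ρ i).π _ (y i) = ((ρ i).U s : Y i →L[ℝ] Y i)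
      ((ρ i).π a (((ρ i).U s⁻¹ : Y i →L[ℝ] Y i) (y i)))
    rw [(ρ i).covariant]
    simp
  bounded := ⟨C, fun a => lp.norm_mapCLM_le 1 _ (by positivity) fun i => hπ i a⟩
  strongCont := by
    classical
    -- A single summand is invariant and isometrically embedded, so its own strong continuity
    -- suffices.
    have hc : ∀ (i : ι) (z : Y i), Continuous fun r =>
        lp.mapCLM 1 (fun i => ((ρ i).U r : Y i →L[ℝ] Y i)) (hν r) (fun i => hU i r)
          (lp.single 1 i z) := fun i z => by
      simp only [mapCLM_single]
      exact (lp.isometry_single i).continuous.comp ((ρ i).strongCont z)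
    intro y
    change Continuous fun r =>
      lp.mapCLM 1 (fun i => ((ρ i).U r : Y i →L[ℝ] Y i)) (hν r) (fun i => hU i r) y
    rw [continuous_iff_continuousAt]
    intro s
    obtain ⟨K, hK, hKs⟩ := exists_compact_mem_nhds s
    obtain ⟨M, hM⟩ := hνK K hK
    set S := fun r => lp.mapCLM (1 : ℝ≥0∞) (fun i => ((ρ i).U r : Y i →L[ℝ] Y i)) (hν r)
      (fun i => hU i r) with hS
    have hSM : ∀ r ∈ K, ‖S r‖ ≤ M := fun r hr =>
      (lp.norm_mapCLM_le 1 _ _ _).trans (hM ⟨r, hr, rfl⟩)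
    have hcl : ContinuousOn (fun r => S r y) K := by
      refine lp_closed_induction (p := fun y => ContinuousOn (fun r => S r y) K) ?_ ?_ ?_ ?_ y
      · simpa only [map_zero] using continuousOn_const
      · intro y z hy hz
        simp only [map_add]
        exact hy.add hz
      -- The operators are uniformly bounded on K, so orbit maps of nearby vectors are uniformly
      -- close on K, and uniform limits of continuous functions are continuous.
      · refine isClosed_of_closure_subset fun y hy => ?_
        have hM0 : 0 ≤ M := (norm_nonneg _).trans (hSM s (mem_of_mem_nhds hKs))
        refine continuousOn_of_uniform_approx_of_continuousOn fun u hu => ?_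
        obtain ⟨ε, hε, hεu⟩ := Metric.mem_uniformity_dist.1 hu
        -- The divisor is M + 1 rather than M because M may be 0.
        obtain ⟨z, hz, hzy⟩ := Metric.mem_closure_iff.1 hy (ε / (M + 1)) (by positivity)
        refine ⟨_, hz, fun r hr => hεu ?_⟩
        rw [dist_eq_norm, ← map_sub]
        rw [dist_eq_norm] at hzy
        calc ‖S r (y - z)‖ ≤ M * ‖y - z‖ := (S r).le_of_opNorm_le (hSM r hr) _
          _ ≤ (M + 1) * ‖y - z‖ := by gcongr; linarith
          _ < (M + 1) * (ε / (M + 1)) := by gcongr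
          _ = ε := by field_simp
      · exact fun i z => (hc i z).continuousOn
    exact hcl.continuousAt hKs

section Properties

variable {ρ : ∀ i, CovRep α (Y i)} {C : ℝ} {ν : G → ℝ} {hC : 0 ≤ C}
    {hν : ∀ r, 0 ≤ ν r} {hνK : ∀ K : Set G, IsCompact K → BddAbove (ν '' K)}
    {hπ : ∀ i a, ‖(ρ i).π a‖ ≤ C * ‖a‖}
    {hU : ∀ i r, ‖((ρ i).U r : Y i →L[ℝ] Y i)‖ ≤ ν r}

theorem CovRep.directSum_π_single [DecidableEq ι] (a : A) (i : ι) (z : Y i) :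
    (directSum ρ hC hν hνK hπ hU).π a (lp.single 1 i z) = lp.single 1 i ((ρ i).π a z) :=
  mapCLM_single (fun i => (ρ i).π a) (by positivity) (fun i => hπ i a) i z

theorem CovRep.directSum_isPositive {Apos : PointedCone ℝ A} {D : ∀ i, PointedCone ℝ (Y i)}
    (h : ∀ i, (ρ i).IsPositive Apos (D i)) :
    (directSum ρ hC hν hνK hπ hU).IsPositive Apos (lpCone D) :=
  ⟨fun a ha _ hy i => (h i).1 a ha _ (hy i), fun s _ hy i => (h i).2 s _ (hy i)⟩

theorem CovRep.directSum_nonDegenerate (h : ∀ i, NonDegenerate (ρ i).π) :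
    NonDegenerate (directSum ρ hC hν hνK hπ hU).π := by
  classical
  set V := Submodule.span ℝ {y : lp Y 1 | ∃ (a : A) (z : lp Y 1),
    y = (directSum ρ hC hν hνK hπ hU).π a z} with hV
  refine fun y => lp_closed_induction (p := fun y => y ∈ V.topologicalClosure)
    (zero_mem _) (fun _ _ => add_mem) V.isClosed_topologicalClosure (fun i z => ?_) y
  let J := lp.singleContinuousLinearMap ℝ Y 1 i
  -- Pulled back along the inclusion of the i-th summand, the closed span contains the span
  -- belonging to `ρ i`, which is dense there; being closed, it contains the whole summand.
  have hle : Submodule.span ℝ {y : Y i | ∃ (a : A) (z : Y i), y = (ρ i).π a z} ≤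
      V.topologicalClosure.comap (J : Y i →ₗ[ℝ] lp Y 1) := by
    refine Submodule.span_le.2 ?_
    rintro _ ⟨a, z, rfl⟩
    refine V.le_topologicalClosure (Submodule.subset_span ⟨a, lp.single 1 i z, ?_⟩)
    exact (directSum_π_single a i z).symm
  exact closure_minimal hle (V.isClosed_topologicalClosure.preimage J.continuous) (h i z)

end Properties

end DirectSum


/-! ### Lower bound for the left regular representation. -/

/-- If the left regular representation is an embedding, it is bounded below. -/
theorem exists_norm_le_mul_norm_leftReg {E : Type*} [NonUnitalNormedRing E] [NormedSpace ℝ E]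
    [IsScalarTower ℝ E E] [SMulCommClass ℝ E E] (h : IsEmbedding (leftReg E)) :
    ∃ K : ℝ, 0 ≤ K ∧ ∀ e : E, ‖e‖ ≤ K * ‖(leftReg E e : E →L[ℝ] E)‖ := by
  -- The centralizer algebra carries the subspace topology, so λ is also an embedding into all
  -- bounded operators; a linear embedding of normed spaces is bounded below.
  obtain ⟨K, hK⟩ := (ContinuousLinearMap.mul ℝ E).antilipschitz_of_isEmbedding
    (IsEmbedding.subtypeVal.comp h)
  exact ⟨K, K.2, fun e => (ContinuousLinearMap.mul ℝ E).bound_of_antilipschitz hK e⟩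

variable {A : Type u} {G : Type v} [NonUnitalNormedRing A] [NormedSpace ℝ A] [IsScalarTower ℝ A A]
  [SMulCommClass ℝ A A] [CompleteSpace A]
  [Group G] [TopologicalSpace G] [IsTopologicalGroup G] [LocallyCompactSpace G]
  [MeasurableSpace G] [BorelSpace G]
  {α : DynSys A G} (μ : Measure G) [μ.IsHaarMeasure]

/-! ### Integrated forms of ℓ¹-direct sums. -/

section DirectSum

variable {ι : Type x} {Y : ι → Type w} [∀ i, NormedAddCommGroup (Y i)] [∀ i, NormedSpace ℝ (Y i)]
  [∀ i, CompleteSpace (Y i)]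
  {ρ : ∀ i, CovRep α (Y i)} {C : ℝ} {ν : G → ℝ} {hC : 0 ≤ C}
    {hν : ∀ r, 0 ≤ ν r} {hνK : ∀ K : Set G, IsCompact K → BddAbove (ν '' K)}
    {hπ : ∀ i a, ‖(ρ i).π a‖ ≤ C * ‖a‖}
    {hU : ∀ i r, ‖((ρ i).U r : Y i →L[ℝ] Y i)‖ ≤ ν r}

/-- Coordinate evaluation is bounded and linear, so it passes through the integral. -/
theorem CovRep.directSum_integratedForm_apply (f : C_c(G, A)) (y : lp Y 1) (i : ι) :
    (directSum ρ hC hν hνK hπ hU).integratedForm μ f y i = (ρ i).integratedForm μ f (y i) := by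
  rw [integratedForm_apply, integratedForm_apply]
  exact ((lp.evalCLM ℝ Y 1 i).integral_comp_comm (integrand_integrable μ _ f y)).symm

theorem CovRep.norm_directSum_integratedForm_le (f : C_c(G, A)) {K : ℝ} (hK : 0 ≤ K)
    (h : ∀ i, ‖(ρ i).integratedForm μ f‖ ≤ K) :
    ‖(directSum ρ hC hν hνK hπ hU).integratedForm μ f‖ ≤ K := by
  have : (directSum ρ hC hν hνK hπ hU).integratedForm μ f =
      lp.mapCLM 1 (fun i => (ρ i).integratedForm μ f) hK h := by
    ext y i
    rw [directSum_integratedForm_apply, mapCLM_apply]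
  rw [this]
  exact lp.norm_mapCLM_le 1 _ _ _

/-- The operator of the i-th summand is a compression: embed by the isometric `lp.single`, apply the
direct sum, then evaluate at i, which is contractive. -/
theorem CovRep.le_norm_directSum_integratedForm (f : C_c(G, A)) (i : ι) :
    ‖(ρ i).integratedForm μ f‖ ≤ ‖(directSum ρ hC hν hνK hπ hU).integratedForm μ f‖ := by
  classical
  refine ContinuousLinearMap.opNorm_le_bound _ (norm_nonneg _) fun z => ?_
  have h := directSum_integratedForm_apply (hC := hC) (hν := hν) (hνK := hνK) (hπ := hπ)
    (hU := hU) μ f (lp.single 1 i z) i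
  rw [lp.single_apply_self] at h
  rw [← h]
  refine (lp.norm_apply_le_norm one_ne_zero _ i).trans ?_
  refine (ContinuousLinearMap.le_opNorm _ _).trans_eq ?_
  rw [lp.norm_single zero_lt_one]

end DirectSum

/-- Some positive non-degenerate `R`-continuous covariant representation has an integrated form
that is bounded below with respect to `σ^R`. -/
theorem UnifBddClass.exists_bounded_below (R : UnifBddClass.{u, v, w} α) (Apos : PointedCone ℝ A)
    (hR : ∀ ρ ∈ R.reps, IsClosed (ρ.cone : Set ρ.X) ∧ ρ.rep.IsPositive Apos ρ.cone ∧
      NonDegenerate ρ.rep.π) :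
    ∃ (X : Type (max u v w)) (_ : NormedAddCommGroup X) (_ : NormedSpace ℝ X)
      (_ : CompleteSpace X) (Xpos : PointedCone ℝ X) (ρ : CovRep α X),
      IsClosed (Xpos : Set X) ∧ ρ.IsPositive Apos Xpos ∧ NonDegenerate ρ.π ∧
      ρ.IsContinuousWrt μ R ∧ ∀ f : C_c(G, A), R.sigma μ f ≤ 2 * ‖ρ.integratedForm μ f‖ := by
  -- The supremum σ^R(f) need not be attained; if it is positive, some member of R exceeds half of
  -- it, whence the 2.
  have hex : ∀ f : C_c(G, A), ∃ ρ : R.reps,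
      R.sigma μ f ≤ 2 * ‖ρ.1.rep.integratedForm μ f‖ := fun f => by
    by_cases h0 : R.sigma μ f = 0
    · exact ⟨Classical.arbitrary _, by rw [h0]; positivity⟩
    · have hpos : 0 < R.sigma μ f := lt_of_le_of_ne (apply_nonneg _ _) (Ne.symm h0)
      obtain ⟨ρ, hρ⟩ := exists_lt_of_lt_ciSup
        (show R.sigma μ f / 2 < ⨆ ρ : R.reps, ‖ρ.1.rep.integratedForm μ f‖ from half_lt_self hpos)
      exact ⟨ρ, by linarith⟩
  choose s hs using hex
  obtain ⟨C, ν, hC, hν, hνK, h⟩ := R.unifBdd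
  -- Summing over f, with one chosen member of R for each f, keeps the space in the universe `max u
  -- v w`; a sum over all of `R.reps` could leave it.
  refine ⟨lp (fun f : C_c(G, A) => (s f).1.X) 1, inferInstance, inferInstance, inferInstance,
    lpCone fun f => (s f).1.cone,
    CovRep.directSum (fun f => (s f).1.rep) hC hν hνK (fun f => (h _ (s f).2).1)
      (fun f => (h _ (s f).2).2),
    isClosed_lpCone fun f => (hR _ (s f).2).1,
    CovRep.directSum_isPositive fun f => (hR _ (s f).2).2.1,
    CovRep.directSum_nonDegenerate fun f => (hR _ (s f).2).2.2,
    ⟨1, fun f => ?_⟩, fun f => (hs f).trans ?_⟩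
  · rw [one_mul]
    exact CovRep.norm_directSum_integratedForm_le μ f (apply_nonneg _ _) fun g =>
      R.norm_le_sigma μ (s g) f
  -- The summand with index f is the one chosen to almost attain σ^R(f).
  · gcongr
    exact CovRep.le_norm_directSum_integratedForm (ρ := fun f => (s f).1.rep) μ f f

/-! ### Transfer, positivity and commutation properties of integrated forms. -/

/-- The integrated form of a covariant representation by left centralizers is carried to the
integrated form of its image under a non-degenerate bounded representation. -/
theorem CovRep.rep_eq_integratedForm {E : Type x} [NonUnitalNormedRing E] [NormedSpace ℝ E]
    [IsScalarTower ℝ E E] [SMulCommClass ℝ E E] [CompleteSpace E] (k : CovRep α E)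
    (h1A : ∀ a, k.π a ∈ leftCentralizers E)
    (h1G : ∀ r, (k.U r : E →L[ℝ] E) ∈ leftCentralizers E)
    {X : Type w} [NormedAddCommGroup X] [NormedSpace ℝ X] [CompleteSpace X] (ρ : CovRep α X)
    {T : E →ₙₐ[ℝ] (X →L[ℝ] X)} (hTb : BoundedRep T) (hTn : NonDegenerate T)
    {Tbar : leftCentralizers E →ₙₐ[ℝ] (X →L[ℝ] X)} (hT : ∀ e : E, Tbar (leftReg E e) = T e)
    (hTA : ∀ a, Tbar ⟨k.π a, h1A a⟩ = ρ.π a)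
    (hTG : ∀ r, Tbar ⟨(k.U r : E →L[ℝ] E), h1G r⟩ = (ρ.U r : X →L[ℝ] X))
    {f : C_c(G, A)} {e : E} (he : (leftReg E e : E →L[ℝ] E) = k.integratedForm μ f) :
    T e = ρ.integratedForm μ f := by
  obtain ⟨C, hC⟩ := hTb
  let P : E →L[ℝ] (X →L[ℝ] X) := LinearMap.mkContinuousOfExistsBound
    ({ toFun := T, map_add' := map_add T, map_smul' := map_smul T } : E →ₗ[ℝ] (X →L[ℝ] X)) ⟨C, hC⟩
  -- A left centralizer satisfies L λ(b) = λ(L b); apply `Tbar`.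
  have hcen : ∀ (L : leftCentralizers E) (b : E), T ((L : E →L[ℝ] E) b) = Tbar L * T b := by
    intro L b
    rw [← hT, ← hT, ← map_mul]
    congr 1
    ext c
    exact (L.2 b c).symm
  refine ContinuousLinearMap.coeFn_injective (Continuous.ext_on hTn (T e).continuous
    (ρ.integratedForm μ f).continuous fun y hy => ?_)
  induction hy using Submodule.span_induction with
  | zero => simp only [map_zero]
  | add y z _ _ hy hz => simp only [map_add, hy, hz]
  | smul c y _ hy => simp only [map_smul, hy]
  | mem y hy =>
    obtain ⟨b, z, rfl⟩ := hy
    -- On vectors T(b)z, which span a dense subspace, T e acts through the product e b = (k_A ⋊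
    -- k_G)(f) b. This is an integral in E, through which T can be moved.
    have h1 : T e (T b z) = P (k.integratedForm μ f b) z := by
      rw [← he]
      change (T e * T b) z = T (e * b) z
      rw [map_mul]
    rw [h1, integratedForm_apply, integratedForm_apply]
    refine (((ContinuousLinearMap.apply ℝ X z).comp P).integral_comp_comm
      (k.integrand_integrable μ f b)).symm.trans
      (integral_congr_ae (Eventually.of_forall fun r => ?_))
    change T (k.π (f r) ((k.U r : E →L[ℝ] E) b)) z = _
    rw [hcen ⟨_, h1A _⟩, hcen ⟨_, h1G _⟩, hTA, hTG]
    rfl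

/-- On a positive vector the integrand takes values in the closed cone, hence so does the integral.
-/
theorem CovRep.mapsCone_integratedForm {X : Type w} [NormedAddCommGroup X] [NormedSpace ℝ X]
    [CompleteSpace X] {ρ : CovRep α X} {Apos : PointedCone ℝ A} {Xpos : PointedCone ℝ X}
    (hρ : ρ.IsPositive Apos Xpos) (hX : IsClosed (Xpos : Set X)) {f : C_c(G, A)}
    (hf : ∀ s, f s ∈ Apos) : MapsCone Xpos Xpos (ρ.integratedForm μ f) := fun y hy =>
  integral_mem_closedCone Xpos hX (ρ.integrand_integrable μ f y) fun s =>
    hρ.1 _ (hf s) _ (hρ.2 s y hy)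

/-- A bounded operator that commutes with a covariant representation commutes with its integrated
form. -/
theorem CovRep.integratedForm_commute {X : Type w} [NormedAddCommGroup X] [NormedSpace ℝ X]
    [CompleteSpace X] (ρ : CovRep α X) {θ : X →L[ℝ] X} (hπ : ∀ a, Commute θ (ρ.π a))
    (hU : ∀ r, Commute θ (ρ.U r : X →L[ℝ] X)) (f : C_c(G, A)) :
    Commute θ (ρ.integratedForm μ f) := by
  ext y
  change θ (ρ.integratedForm μ f y) = ρ.integratedForm μ f (θ y)
  rw [integratedForm_apply, integratedForm_apply,
    ← θ.integral_comp_comm (ρ.integrand_integrable μ f y)]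
  refine integral_congr_ae (Eventually.of_forall fun r => ?_)
  have h := (hπ (f r)).mul_right (hU r)
  exact DFunLike.congr_fun h.eq y

/-! ### Uniqueness of the intertwiner. -/

variable (R : UnifBddClass.{u, v, w} α)
  {E : Type x} [NonUnitalNormedRing E] [NormedSpace ℝ E] [IsScalarTower ℝ E E]
  [SMulCommClass ℝ E E] [CompleteSpace E]

theorem CrossedProduct.IsIntertwiner.apply_iA {k : CovRep α E} {ψ : CrossedProduct μ R ≃L[ℝ] E}
    (h : IsIntertwiner μ R k ψ) (a : A) (d : CrossedProduct μ R) :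
    ψ ((iA μ R a : CrossedProduct μ R →L[ℝ] CrossedProduct μ R) d) = k.π a (ψ d) := by
  simp [h.map_iA]

theorem CrossedProduct.IsIntertwiner.apply_iG {k : CovRep α E} {ψ : CrossedProduct μ R ≃L[ℝ] E}
    (h : IsIntertwiner μ R k ψ) (r : G) (d : CrossedProduct μ R) :
    ψ ((iG μ R r : CrossedProduct μ R →L[ℝ] CrossedProduct μ R) d) =
      (k.U r : E →L[ℝ] E) (ψ d) := by
  simp [h.map_iG]

/-- Intertwiners are unique if the integrated form of `k` has dense range in `λ(E)`. -/
theorem CrossedProduct.IsIntertwiner.unique {k : CovRep α E} {φ ψ : CrossedProduct μ R ≃L[ℝ] E}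
    (hφ : IsIntertwiner μ R k φ) (hψ : IsIntertwiner μ R k ψ)
    (hinj : Function.Injective (leftReg E))
    (h3 : ∀ e : E, (leftReg E e : E →L[ℝ] E) ∈ closure (Set.range (k.integratedForm μ))) :
    φ = ψ := by
  set θ : E ≃L[ℝ] E := ψ.symm.trans φ with hθ
  have hθψ : ∀ d, θ (ψ d) = φ d := fun d => by simp [hθ]
  have hcomm : ∀ f : C_c(G, A), Commute (θ : E →L[ℝ] E) (k.integratedForm μ f) := by
    refine k.integratedForm_commute μ (fun a => ?_) fun r => ?_
    · ext y
      obtain ⟨d, rfl⟩ := ψ.surjective y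
      change θ (k.π a (ψ d)) = k.π a (θ (ψ d))
      rw [← hψ.apply_iA, hθψ, hθψ, hφ.apply_iA]
    · ext y
      obtain ⟨d, rfl⟩ := ψ.surjective y
      change θ ((k.U r : E →L[ℝ] E) (ψ d)) = (k.U r : E →L[ℝ] E) (θ (ψ d))
      rw [← hψ.apply_iG, hθψ, hθψ, hφ.apply_iG]
  -- The commutant of θ is norm closed, so commutation with all integrated forms passes to all λ(e).
  have hclosed : IsClosed {S : E →L[ℝ] E | Commute (θ : E →L[ℝ] E) S} :=
    isClosed_eq (continuous_const.mul continuous_id) (continuous_id.mul continuous_const)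
  have hleft : ∀ e c : E, θ (e * c) = e * θ c := fun e c =>
    DFunLike.congr_fun (closure_minimal (Set.range_subset_iff.2 hcomm) hclosed (h3 e)).eq c
  have hmul : ∀ e c : E, θ (e * c) = θ e * θ c := fun e c => by
    obtain ⟨d, rfl⟩ := ψ.surjective e
    obtain ⟨b, rfl⟩ := ψ.surjective c
    rw [← hψ.map_mul, hθψ, hθψ, hθψ, hφ.map_mul]
  ext d
  rw [← hθψ]
  -- With e = ψ d, it suffices that λ(θ e) = λ(e). By surjectivity of θ this may be tested on
  -- vectors θ b, where θ(e)θ(b) = θ(e b) = e θ(b).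
  refine hinj (Subtype.ext (ContinuousLinearMap.ext fun c => ?_))
  obtain ⟨b, rfl⟩ := θ.surjective c
  change θ (ψ d) * θ b = ψ d * θ b
  rw [← hmul, hleft]

end OrderedCrossedProduct

/-! ### Construction of the isomorphism and its bipositivity. -/

theorem theorem4p7
    {A : Type u} {G : Type v} {E : Type x}
    -- the Banach algebra `A` and the locally compact group `G` with its left Haar measure
    [NonUnitalNormedRing A] [NormedSpace ℝ A] [IsScalarTower ℝ A A] [SMulCommClass ℝ A A]
    [CompleteSpace A]
    [Group G] [TopologicalSpace G] [IsTopologicalGroup G] [LocallyCompactSpace G] [T2Space G]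
    [MeasurableSpace G] [BorelSpace G] (μ : Measure G) [μ.IsHaarMeasure]
    -- `A` is pre-ordered, with a closed cone and a positive bounded approximate left identity
    (Apos : PointedCone ℝ A) (hA_mul : ∀ a ∈ Apos, ∀ b ∈ Apos, a * b ∈ Apos)
    (hA_closed : IsClosed (Apos : Set A)) (hA_id : HasPosBddApproxLeftId Apos)
    -- the positive action
    (α : DynSys A G) (hα : α.IsPositive Apos)
    -- the class `R`
    (R : UnifBddClass.{u, v, w} α)
    (hR : ∀ ρ ∈ R.reps, IsClosed (ρ.cone : Set ρ.X) ∧ ρ.rep.IsPositive Apos ρ.cone ∧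
      NonDegenerate ρ.rep.π)
    -- the pre-ordered Banach algebra `E`
    [NonUnitalNormedRing E] [NormedSpace ℝ E] [IsScalarTower ℝ E E] [SMulCommClass ℝ E E]
    [CompleteSpace E]
    (Epos : PointedCone ℝ E) (hE_mul : ∀ a ∈ Epos, ∀ b ∈ Epos, a * b ∈ Epos)
    (hE_closed : IsClosed (Epos : Set E)) (hE_id : HasPosBddApproxLeftId Epos)
    (hlam_emb : IsEmbedding (leftReg E))
    (hlam_bipos : ∀ e : E, e ∈ Epos ↔ MapsCone Epos Epos (leftReg E e : E →L[ℝ] E))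
    -- the covariant representation `(k_A, k_G)` on `E`
    (k : CovRep α E) (hk_pos : k.IsPositive Apos Epos) (hk_nondeg : NonDegenerate k.π)
    (hk_cont : k.IsContinuousWrt μ R)
    (h1A : ∀ a, k.π a ∈ leftCentralizers E)
    (h1G : ∀ r, (k.U r : E →L[ℝ] E) ∈ leftCentralizers E)
    (h2 : ∀ f : C_c(G, A), ∃ e : E, (leftReg E e : E →L[ℝ] E) = k.integratedForm μ f)
    (h3 : ∀ e : E, (leftReg E e : E →L[ℝ] E) ∈ closure (Set.range (k.integratedForm μ)))
    (h4 : ∀ e : E, MapsCone Epos Epos (leftReg E e : E →L[ℝ] E) →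
      (leftReg E e : E →L[ℝ] E) ∈
        closure {S | ∃ f : C_c(G, A), (∀ s, f s ∈ Apos) ∧ k.integratedForm μ f = S})
    -- `(E, k_A, k_G)` generates all positive non-degenerate `R`-continuous covariant
    -- representations on pre-ordered Banach spaces with closed cones
    (hgen : ∀ (X : Type (max u v w)) [NormedAddCommGroup X] [NormedSpace ℝ X] [CompleteSpace X]
      (Xpos : PointedCone ℝ X) (ρ : CovRep α X), IsClosed (Xpos : Set X) →
      ρ.IsPositive Apos Xpos → NonDegenerate ρ.π → ρ.IsContinuousWrt μ R →
      ∃ T : E →ₙₐ[ℝ] (X →L[ℝ] X),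
        BoundedRep T ∧ NonDegenerate T ∧ (∀ e ∈ Epos, MapsCone Xpos Xpos (T e)) ∧
        ∃ Tbar : leftCentralizers E →ₙₐ[ℝ] (X →L[ℝ] X),
          (∀ e : E, Tbar (leftReg E e) = T e) ∧
          (∀ a, Tbar ⟨k.π a, h1A a⟩ = ρ.π a) ∧
          ∀ r, Tbar ⟨(k.U r : E →L[ℝ] E), h1G r⟩ = (ρ.U r : X →L[ℝ] X)) :
    ∃ ψ : CrossedProduct μ R ≃L[ℝ] E,
      CrossedProduct.IsIntertwiner μ R k ψ ∧
      (∀ φ : CrossedProduct μ R ≃L[ℝ] E, CrossedProduct.IsIntertwiner μ R k φ → φ = ψ) ∧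
      ∀ d : CrossedProduct μ R, d ∈ CrossedProduct.cone μ R Apos ↔ ψ d ∈ Epos := by
  obtain ⟨K, hK0, hK⟩ := exists_norm_le_mul_norm_leftReg hlam_emb
  have hinj : Function.Injective (leftReg E) := hlam_emb.injective
  obtain ⟨X, _, _, _, Xpos, ρ, hXc, hρpos, hρnd, hρcont, hρσ⟩ := R.exists_bounded_below μ Apos hR
  obtain ⟨T, hTb, hTn, -, Tbar, hT, hTA, hTG⟩ := hgen X Xpos ρ hXc hρpos hρnd hρcont
  obtain ⟨M, hM⟩ := hk_cont
  choose ε hε using h2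
  have heq : ∀ {e c : E}, (leftReg E e : E →L[ℝ] E) = leftReg E c → e = c := fun h =>
    hinj (Subtype.ext h)
  let Λ : C_c(G, A) →ₗ[ℝ] E :=
    { toFun := ε
      map_add' f g := heq <| by
        rw [hε, CovRep.integratedForm_add, ← hε, ← hε]
        exact (map_add (ContinuousLinearMap.mul ℝ E) _ _).symm
      map_smul' c f := heq <| by
        rw [hε, CovRep.integratedForm_smul, ← hε]
        exact (map_smul (ContinuousLinearMap.mul ℝ E) _ _).symm }
  have hΛ : ∀ f, (leftReg E (Λ f) : E →L[ℝ] E) = k.integratedForm μ f := hε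
  have hΛσ : ∀ f, ‖Λ f‖ ≤ K * M * R.sigma μ f := fun f => by
    rw [mul_assoc]
    refine (hK _).trans ?_
    rw [hΛ]
    gcongr
    exact hM f
  obtain ⟨C, hC⟩ := hTb
  -- The factor 2 comes from the choice of ρ and the rest from the bound of T, since T(Λ f) is the
  -- integrated form of ρ. The maximum with 0 makes the constant nonnegative.
  have hσΛ : ∀ f, R.sigma μ f ≤ 2 * max C 0 * ‖Λ f‖ := fun f => by
    refine (hρσ f).trans ?_
    rw [mul_assoc, ← k.rep_eq_integratedForm μ h1A h1G ρ ⟨C, hC⟩ hTn hT hTA hTG (hΛ f)]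
    gcongr
    exact (hC _).trans (by gcongr; exact le_max_left _ _)
  let Ψ : CrossedProduct μ R →L[ℝ] E := CrossedProduct.induced μ R Λ
  have hΨ : ∀ f, Ψ (CrossedProduct.q μ R f) = Λ f := CrossedProduct.induced_q μ R ⟨_, hΛσ⟩
  have hΨanti : ∃ c, AntilipschitzWith c Ψ := by
    refine ⟨⟨2 * max C 0, by positivity⟩, Ψ.antilipschitz_of_bound fun d => ?_⟩
    refine (CrossedProduct.denseRange_q μ R).induction_on (p := fun d => ‖d‖ ≤ _ * ‖Ψ d‖) d
      (isClosed_le continuous_norm (continuous_const.mul Ψ.continuous.norm)) fun f => ?_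
    rw [hΨ, CrossedProduct.norm_q]
    exact hσΛ f
  -- Hypotheses `h3` and `h4` give closures among operators; as λ is inducing, they pull back to
  -- closures in E.
  have hind : IsInducing (ContinuousLinearMap.mul ℝ E) :=
    (IsEmbedding.subtypeVal.comp hlam_emb).isInducing
  have hdense : Dense (Ψ.range : Set E) := fun e => by
    rw [hind.closure_eq_preimage_closure_image]
    refine closure_mono ?_ (h3 e)
    rintro _ ⟨f, rfl⟩
    exact ⟨Λ f, ⟨_, hΨ f⟩, hΛ f⟩
  -- The crossed product is complete, so an operator bounded below has closed range; density makes
  -- it surjective.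
  have hbij := Ψ.bijective_iff_dense_range_and_antilipschitz.2
    ⟨(Submodule.dense_iff_topologicalClosure_eq_top).1 hdense, hΨanti⟩
  let ψ : CrossedProduct μ R ≃L[ℝ] E := ContinuousLinearEquiv.ofBijective Ψ
    (LinearMap.ker_eq_bot.2 hbij.1) (LinearMap.range_eq_top.2 hbij.2)
  have hψ : ∀ f, ψ (CrossedProduct.q μ R f) = Λ f := hΨ
  have hint : CrossedProduct.IsIntertwiner μ R k ψ := by
    refine ⟨fun c d => ?_, fun a => ?_, fun r => ?_⟩
    · refine DenseRange.induction_on₂ (CrossedProduct.denseRange_q μ R)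
        (p := fun c d => ψ (c * d) = ψ c * ψ d)
        (isClosed_eq (ψ.continuous.comp (continuous_fst.mul continuous_snd))
          ((ψ.continuous.comp continuous_fst).mul (ψ.continuous.comp continuous_snd)))
        (fun f g => heq ?_) c d
      rw [CrossedProduct.q_mul, hψ, hψ, hψ, hΛ, CovRep.integratedForm_conv, ← hΛ, ← hΛ]
      exact ContinuousLinearMap.ext fun e => (mul_assoc _ _ _).symm
    -- It is enough to show k_A(a) ψ = ψ i_A(a) on the image of C_c(G, A). After applying λ, the
    -- centralizer property takes k_A(a) out of λ, and `CovRep.integratedForm_preIA` absorbs it.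
    · have h : (k.π a).comp (ψ : CrossedProduct μ R →L[ℝ] E) =
          (ψ : CrossedProduct μ R →L[ℝ] E) ∘L
            (CrossedProduct.iA μ R a : CrossedProduct μ R →L[ℝ] CrossedProduct μ R) := by
        refine ContinuousLinearMap.coeFn_injective ((CrossedProduct.denseRange_q μ R).equalizer
          (ContinuousLinearMap.continuous _) (ContinuousLinearMap.continuous _)
          (funext fun f => heq ?_))
        change (leftReg E (k.π a (ψ (CrossedProduct.q μ R f))) : E →L[ℝ] E) = leftReg E
          (ψ (CrossedProduct.induced μ R (CrossedProduct.qIA μ R a) (CrossedProduct.q μ R f)))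
        rw [CrossedProduct.induced_qIA, hψ, hψ, hΛ, CovRep.integratedForm_preIA, ← hΛ]
        exact ContinuousLinearMap.ext fun e => (h1A a _ _).symm
      rw [← ContinuousLinearMap.comp_assoc, ← h]
      ext e
      simp
    · have h : (k.U r : E →L[ℝ] E).comp (ψ : CrossedProduct μ R →L[ℝ] E) =
          (ψ : CrossedProduct μ R →L[ℝ] E) ∘L
            (CrossedProduct.iG μ R r : CrossedProduct μ R →L[ℝ] CrossedProduct μ R) := by
        refine ContinuousLinearMap.coeFn_injective ((CrossedProduct.denseRange_q μ R).equalizer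
          (ContinuousLinearMap.continuous _) (ContinuousLinearMap.continuous _)
          (funext fun f => heq ?_))
        change (leftReg E ((k.U r : E →L[ℝ] E) (ψ (CrossedProduct.q μ R f))) : E →L[ℝ] E) =
          leftReg E
          (ψ (CrossedProduct.induced μ R (CrossedProduct.qIG μ R r) (CrossedProduct.q μ R f)))
        rw [CrossedProduct.induced_qIG, hψ, hψ, hΛ, CovRep.integratedForm_preIG, ← hΛ]
        exact ContinuousLinearMap.ext fun e => (h1G r _ _).symm
      rw [← ContinuousLinearMap.comp_assoc, ← h]
      ext e
      simp
  refine ⟨ψ, hint, fun φ hφ => hφ.unique μ R hint hinj h3, fun d => ⟨fun hd => ?_, fun hd => ?_⟩⟩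
  -- The preimage of the closed cone of E is closed, so only the images of A₊-valued functions
  -- matter; for these λ(Λ f) is a positive operator, and λ reflects positivity.
  · refine closure_minimal ?_ (hE_closed.preimage ψ.continuous) hd
    rintro _ ⟨f, hf, rfl⟩
    change ψ (CrossedProduct.q μ R f) ∈ Epos
    rw [hψ, hlam_bipos, hΛ]
    exact CovRep.mapsCone_integratedForm μ hk_pos hE_closed hf
  -- Since λ(ψ d) is positive, `h4` approximates it by integrated forms of A₊-valued functions;
  -- pulling back along λ and then applying ψ⁻¹ puts d in the closure defining the cone.
  · have hcl : ψ d ∈ closure {e : E | ∃ f : C_c(G, A), (∀ s, f s ∈ Apos) ∧ Λ f = e} := by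
      rw [hind.closure_eq_preimage_closure_image]
      refine closure_mono ?_ (h4 _ ((hlam_bipos _).1 hd))
      rintro _ ⟨f, hf, rfl⟩
      exact ⟨Λ f, ⟨f, hf, rfl⟩, hΛ f⟩
    have himg := mem_closure_image ψ.symm.continuous.continuousAt hcl
    rw [ψ.symm_apply_apply] at himg
    refine closure_mono ?_ himg
    rintro _ ⟨_, ⟨f, hf, rfl⟩, rfl⟩
    exact ⟨f, hf, by rw [← hψ, ψ.symm_apply_apply]⟩
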